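/- **Hecke–Funk Theorem.** Let $p\ge 2$ and $n\ge 0$ be integers, let $S^{p-1}$ be the unit sphere of $\mathbb R^p$ with its (unnormalized) surface measure $d\Omega_{p-1}$, and let $\Omega_{k}$ be the surface area of the unit sphere $S^{k}\subset\mathbb R^{k+1}$ (so $\Omega_0=2$). A *spherical harmonic of degree $n$* is the restriction $Y_n$ to $S^{p-1}$ of a real homogeneous polynomial of degree $n$ in $p$ variables that is harmonic, $\sum_i \partial^2 H/\partial x_i^2=0$ (the zero function is allowed). The *Legendre polynomial of degree $n$ in $p$ dimensions* is the real polynomial $P_n$ in one variable such that, with $e_1=(1,0,\dots,0)$, there is a harmonic homogeneous polynomial $L_n$ of degree $n$ in $p$ variables with $L_n(e_1)=1$, with $L_n(Rx)=L_n(x)$ for every $x\in\mathbb R^p$ and every orthogonal matrix $R$ such that $Re_1=e_1$, and with $L_n(\xi)=P_n(\langle \xi,e_1\rangle)$ for all $\xi\in S^{p-1}$. There is exactly one such polynomial $P_n$. Let $\xi\in S^{p-1}$, let $Y_n$ be a spherical harmonic of degree $n$, and let $f$ be a real-valued function (only its values on $[-1,1]$ matter). If $\eta\mapsto f(\langle\xi,\eta\rangle)Y_n(\eta)$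 is integrable on $S^{p-1}$, then $$\int_{S^{p-1}} f(\langle\xi,\eta\rangle)\,Y_n(\eta)\,d\Omega_{p-1}(\eta)=\Omega_{p-2}\,Y_n(\xi)\int_{-1}^{1} f(t)\,P_n(t)\,(1-t^2)^{(p-3)/2}\,dt ,$$ where the integrand on the right is integrable on $[-1,1]$ if $Y_n(\xi)\ne0$, and the right-hand side is read as $0$ if $Y_n(\xi)=0$. Moreover, if $t\mapsto f(t)(1-t^2)^{(p-3)/2}$ is integrable on $[-1,1]$, then the integrands on both sides are integrable, so that the formula holds. -/

import Mathlib

open MeasureTheory Polynomial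
open scoped Matrix

/-- The unit sphere `S^{p-1}` of `ℝ^p`. -/
abbrev UnitSphere (p : ℕ) : Type :=
  Metric.sphere (0 : EuclideanSpace ℝ (Fin p)) 1

/-- The surface measure `dΩ_{p-1}` on `S^{p-1}` (not normalized). -/
noncomputable def surfaceMeasure (p : ℕ) : Measure (UnitSphere p) :=
  (volume : Measure (EuclideanSpace ℝ (Fin p))).toSphere

/-- `Ω_k`, the total surface area of the unit sphere `S^k` of `ℝ^{k+1}`. -/
noncomputable def sphereArea (k : ℕ) : ℝ :=
  (surfaceMeasure (k + 1)).real Set.univ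

/-- `q` is harmonic: `∑ i, ∂²q/∂x_i² = 0`. -/
def IsHarmonicPolynomial {p : ℕ} (q : MvPolynomial (Fin p) ℝ) : Prop :=
  ∑ i, MvPolynomial.pderiv i (MvPolynomial.pderiv i q) = 0

/-- The restriction of the polynomial `q` to the unit sphere. -/
noncomputable def restrictToSphere {p : ℕ} (q : MvPolynomial (Fin p) ℝ) : UnitSphere p → ℝ :=
  fun ξ => MvPolynomial.eval (fun i => ξ.1 i) q

/-- A spherical harmonic of degree `n`: the restriction to the unit sphere of a harmonic
homogeneous polynomial of degree `n`. -/
def IsSphericalHarmonic {p : ℕ} (n : ℕ) (Y : UnitSphere p → ℝ) : Prop :=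
  ∃ H : MvPolynomial (Fin p) ℝ,
    H.IsHomogeneous n ∧ IsHarmonicPolynomial H ∧ Y = restrictToSphere H

/-- `P` is the Legendre polynomial of degree `n` in `p` dimensions. With `e₁ = (1, 0, …, 0)`, there
is a harmonic homogeneous polynomial `L` of degree `n` with `L e₁ = 1`, invariant under all
orthogonal matrices that fix `e₁`, and `L ξ = P ⟨ξ, e₁⟩` for all unit vectors `ξ`. -/
def IsLegendrePolynomial (p : ℕ) [NeZero p] (n : ℕ) (P : ℝ[X]) : Prop :=
  ∃ L : MvPolynomial (Fin p) ℝ,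
    L.IsHomogeneous n ∧ IsHarmonicPolynomial L ∧
    MvPolynomial.eval (Pi.single 0 1) L = 1 ∧
    (∀ R ∈ Matrix.orthogonalGroup (Fin p) ℝ,
      R *ᵥ (Pi.single 0 1) = Pi.single 0 1 →
        ∀ x : Fin p → ℝ, MvPolynomial.eval (R *ᵥ x) L = MvPolynomial.eval x L) ∧
    ∀ ξ : UnitSphere p,
      restrictToSphere L ξ = P.eval (inner ℝ ξ.1 (EuclideanSpace.single (0 : Fin p) (1 : ℝ)))

/-!
Let `p = d + 1`. The sphere `S^d` is sliced into the parallels about `ξ`. In terms of the colatitude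
`θ` and the direction `ζ ∈ S^{d-1}` the surface measure is `sin^{d-1} θ dθ ⊗ dΩ_{d-1}`
(`measurePreserving_spherePoint`), and on a parallel `f ⟨ξ, η⟩ = f (cos θ)` is constant. By Fubini
everything reduces to the mean of a spherical harmonic over a parallel, which is
`Y ξ * P (cos θ)` (`integral_restrictToSphere_spherePoint`); the substitution `t = cos θ` then gives
the integral over `[-1, 1]`.

For the mean value, let `H` be a harmonic form of degree `n`, written as `∑ x₀^{n-j} h_j` with forms
`h_j` of degree `j` in the other `d` variables. Harmonicity reads
`Δ h_{j+2} = -(n-j)(n-j-1) h_j` (`IsHarmonicPolynomial.laplacian_coeff`), and Green's formula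
`∫ Δ h = j (j + d - 2) ∫ h` on `S^{d-1}` for forms of degree `j`
(`integral_restrictToSphere_laplacian`) turns this into a two-step recursion for the means of the
`h_j`. Hence these means are `H e₁ * b_j` with universal constants `b_j` (`zonalCoeff`), and the
mean of `H` over a parallel is a universal polynomial in `cos θ` times `H e₁`. Green's formula is
obtained from Gaussian integration by parts and Euler's identity on `ℝ^d`, followed by polar
coordinates, which also covers `d = 1`, where `S^{d-1}` consists of two points.

The mean value formula applied to the form `L` in the definition of the Legendre polynomial shows
that the polynomial is unique, equal to `∑ b_j t^{n-j} (1 - t²)^{j/2}` (`zonalPolynomial`). It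
exists because `∑ b_j x₀^{n-j} ρ^{j/2}`, where `ρ = x₁² + ⋯ + x_d²`, is harmonic, by the same
recursion.
-/

/-! ### Polar coordinates and the slicing of the sphere -/

/-- Integration in polar coordinates, for functions that need not be radial. -/
theorem lintegral_eq_lintegral_sphere_lintegral_Ioi {d : ℕ} [NeZero d]
    {G : EuclideanSpace ℝ (Fin d) → ENNReal} (hG : Measurable G) :
    ∫⁻ x, G x = ∫⁻ ζ : UnitSphere d, ∫⁻ r in Set.Ioi (0 : ℝ),
      ENNReal.ofReal (r ^ (d - 1)) * G (r • ζ.1) ∂volume ∂(surfaceMeasure d) := by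
  have hmp := Measure.measurePreserving_homeomorphUnitSphereProd
    (volume : Measure (EuclideanSpace ℝ (Fin d)))
  have h0 : MeasurableSet ({0}ᶜ : Set (EuclideanSpace ℝ (Fin d))) :=
    (measurableSet_singleton _).compl
  have hG' : Measurable fun q : UnitSphere d × Set.Ioi (0 : ℝ) => G (q.2.1 • q.1.1) := by fun_prop
  calc ∫⁻ x, G x = ∫⁻ x in ({0}ᶜ : Set (EuclideanSpace ℝ (Fin d))), G x := by
        rw [restrict_compl_singleton]
    _ = ∫⁻ x : ({0}ᶜ : Set (EuclideanSpace ℝ (Fin d))), G x ∂(volume.comap Subtype.val) :=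
        (lintegral_subtype_comap h0 _).symm
    _ = ∫⁻ q, G (q.2.1 • q.1.1) ∂((surfaceMeasure d).prod (Measure.volumeIoiPow (d - 1))) := by
        have := hmp.lintegral_comp hG'
        rw [finrank_euclideanSpace_fin] at this
        rw [surfaceMeasure, ← this]
        refine lintegral_congr fun x => ?_
        have hx : ‖x.1‖ ≠ 0 := norm_ne_zero_iff.2 x.2
        simp [smul_smul, hx]
    _ = _ := by
        rw [lintegral_prod _ (hG'.aemeasurable)]
        refine lintegral_congr fun ζ => ?_
        rw [Measure.volumeIoiPow, lintegral_withDensity_eq_lintegral_mul _ (by fun_prop)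
          (by fun_prop)]
        exact lintegral_subtype_comap measurableSet_Ioi
          fun r : ℝ => ENNReal.ofReal (r ^ (d - 1)) * G (r • ζ.1)

/-- The point of `S^d` with colatitude `θ` from the pole `e₁` and direction `ζ ∈ S^{d-1}`:
`(θ, ζ) ↦ (cos θ, sin θ • ζ)`. -/
noncomputable def spherePoint (d : ℕ) (q : ℝ × UnitSphere d) : UnitSphere (d + 1) :=
  ⟨WithLp.toLp 2 (Fin.cons (Real.cos q.1) fun i => Real.sin q.1 * q.2.1 i), by
    have h : ∑ i, (q.2.1 i) ^ 2 = 1 := by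
      rw [← EuclideanSpace.real_norm_sq_eq, norm_eq_of_mem_sphere, one_pow]
    rw [mem_sphere_zero_iff_norm, EuclideanSpace.norm_eq, Real.sqrt_eq_one, Fin.sum_univ_succ]
    simp [mul_pow, ← Finset.mul_sum, h]⟩

@[simp]
theorem spherePoint_zero {d : ℕ} (q : ℝ × UnitSphere d) :
    (spherePoint d q).1 0 = Real.cos q.1 := rfl

@[simp]
theorem spherePoint_succ {d : ℕ} (q : ℝ × UnitSphere d) (i : Fin d) :
    (spherePoint d q).1 i.succ = Real.sin q.1 * q.2.1 i := rfl

theorem continuous_spherePoint (d : ℕ) : Continuous (spherePoint d) := by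
  refine Continuous.subtype_mk ((PiLp.continuous_toLp 2 _).comp (continuous_pi fun i => ?_)) _
  refine Fin.cases ?_ (fun i => ?_) i
  · simp only [Fin.cons_zero]; fun_prop
  · simp only [Fin.cons_succ]; fun_prop

/-- The measure `sin^{d-1} θ dθ` on `(0, π)`: the distribution of the colatitude on `S^d`, up to the
factor `Ω_{d-1}`. -/
noncomputable def colatitudeMeasure (d : ℕ) : Measure ℝ :=
  (volume.restrict (Set.Ioo 0 Real.pi)).withDensity
    fun θ => ENNReal.ofReal (Real.sin θ ^ (d - 1))

instance (d : ℕ) : IsFiniteMeasure (surfaceMeasure d) := by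
  unfold surfaceMeasure; infer_instance

instance (d : ℕ) : SFinite (colatitudeMeasure d) := by
  unfold colatitudeMeasure; infer_instance

theorem measurePreserving_toLp_cons (d : ℕ) :
    MeasurePreserving
      (fun q : ℝ × EuclideanSpace ℝ (Fin d) =>
        (WithLp.toLp 2 (Fin.cons q.1 q.2.ofLp : Fin (d + 1) → ℝ) : EuclideanSpace ℝ (Fin (d + 1))))
      (volume.prod volume) volume := by
  have h1 : MeasurePreserving (Prod.map id WithLp.ofLp : ℝ × EuclideanSpace ℝ (Fin d) → _)
      (volume.prod volume) (volume.prod volume) :=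
    (MeasurePreserving.id volume).prod (PiLp.volume_preserving_ofLp (Fin d))
  have h2 := (volume_preserving_piFinSuccAbove (fun _ : Fin (d + 1) => ℝ) 0).symm
  convert! (PiLp.volume_preserving_toLp (Fin (d + 1))).comp (h2.comp h1) using 1
  funext q
  simp [Fin.insertNthEquiv, MeasurableEquiv.piFinSuccAbove]

/-- Polar coordinates in the upper half plane `{(t, ρ) : ρ > 0}`. -/
theorem lintegral_upper_half_plane {F : ℝ × ℝ → ENNReal} (hF : Measurable F) :
    ∫⁻ t : ℝ, ∫⁻ ρ in Set.Ioi (0 : ℝ), F (t, ρ) =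
      ∫⁻ r in Set.Ioi (0 : ℝ), ∫⁻ θ in Set.Ioo 0 Real.pi,
        ENNReal.ofReal r * F (r * Real.cos θ, r * Real.sin θ) := by
  -- Extend `F` by zero to the lower half plane, which corresponds to `θ ≤ 0`.
  let F' : ℝ × ℝ → ENNReal := (Set.univ ×ˢ Set.Ioi 0).indicator F
  have hF' : Measurable F' := hF.indicator (MeasurableSet.univ.prod measurableSet_Ioi)
  have h := lintegral_comp_polarCoord_symm F'
  rw [Measure.volume_eq_prod, lintegral_prod _ hF'.aemeasurable, polarCoord_target,
    ← Measure.prod_restrict, lintegral_prod _ (by fun_prop)] at h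
  have hl : ∀ t : ℝ, ∫⁻ ρ, F' (t, ρ) = ∫⁻ ρ in Set.Ioi (0 : ℝ), F (t, ρ) := fun t => by
    rw [← lintegral_indicator measurableSet_Ioi]
    refine lintegral_congr fun ρ => ?_
    by_cases hρ : 0 < ρ <;> simp [F', hρ]
  simp_rw [hl] at h
  rw [← h]
  refine setLIntegral_congr_fun measurableSet_Ioi fun r (hr : 0 < r) => ?_
  have hsub : Set.Ioo (0 : ℝ) Real.pi ⊆ Set.Ioo (-Real.pi) Real.pi :=
    Set.Ioo_subset_Ioo_left (by linarith [Real.pi_pos])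
  rw [← Set.inter_eq_left.2 hsub, ← Measure.restrict_restrict (measurableSet_Ioo (a := (0 : ℝ))),
    ← lintegral_indicator (measurableSet_Ioo (a := (0 : ℝ)) (b := Real.pi))]
  refine setLIntegral_congr_fun measurableSet_Ioo fun θ hθ => ?_
  by_cases h0 : 0 < θ
  · have hs : 0 < Real.sin θ := Real.sin_pos_of_pos_of_lt_pi h0 hθ.2
    simp [F', h0, hθ.2, hs, hr]
  · have hs : ¬ 0 < Real.sin θ :=
      not_lt.2 (Real.sin_nonpos_of_nonpos_of_neg_pi_le (not_lt.1 h0) hθ.1.le)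
    simp [F', h0, hs, hr]

/-- The sphere `S^d` is sliced into the parallels of colatitude `θ`: its surface measure is
`sin^{d-1} θ dθ ⊗ dΩ_{d-1}`. Both measures are compared with Lebesgue measure on the unit ball of
`ℝ^{d+1} = ℝ × ℝ^d`, in polar coordinates on the one hand, and in polar coordinates of `ℝ^d`
followed by those of the half plane on the other. -/
theorem measurePreserving_spherePoint (d : ℕ) [NeZero d] :
    MeasurePreserving (spherePoint d) ((colatitudeMeasure d).prod (surfaceMeasure d))
      (surfaceMeasure (d + 1)) := by
  refine ⟨(continuous_spherePoint d).measurable, Measure.ext_of_lintegral _ fun g hg => ?_⟩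
  rw [lintegral_map hg (continuous_spherePoint d).measurable]
  obtain ⟨G, hG, rfl⟩ :=
    (MeasurableEmbedding.subtype_coe (Metric.isClosed_sphere
      (x := (0 : EuclideanSpace ℝ (Fin (d + 1)))) (ε := 1)).measurableSet).exists_measurable_extend
      hg fun _ => ⟨0⟩
  -- Extend `G` radially to the unit ball; `K` is the radial factor common to both computations of
  -- the integral of this extension.
  let k : ℝ → ENNReal := (Set.Iio 1).indicator 1
  have hk : Measurable k := measurable_one.indicator measurableSet_Iio
  let K : ENNReal := ∫⁻ r in Set.Ioi (0 : ℝ), ENNReal.ofReal (r ^ d) * k r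
  have hK : K = ENNReal.ofReal (1 / (d + 1)) := by
    have := Measure.volumeIoiPow_apply_Iio d ⟨1, Set.mem_Ioi.2 one_pos⟩
    rw [Measure.volumeIoiPow, withDensity_apply _ measurableSet_Iio,
      setLIntegral_subtype measurableSet_Ioi _ fun a : ℝ => ENNReal.ofReal (a ^ d),
      Set.image_subtype_val_Ioi_Iio, one_pow] at this
    rw [← this, ← Set.Iio_inter_Ioi, ← Measure.restrict_restrict measurableSet_Iio,
      ← lintegral_indicator measurableSet_Iio]
    refine lintegral_congr fun r => ?_
    by_cases hr : r < 1 <;> simp [k, hr]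
  have hK0 : K ≠ 0 := by
    rw [hK]; simp; positivity
  have hKt : K ≠ ⊤ := by
    rw [hK]; exact ENNReal.ofReal_ne_top
  let G₀ : EuclideanSpace ℝ (Fin (d + 1)) → ENNReal := fun x => G (‖x‖⁻¹ • x) * k ‖x‖
  have hG₀ : Measurable G₀ := by
    have : Measurable fun x : EuclideanSpace ℝ (Fin (d + 1)) => ‖x‖⁻¹ • x := by fun_prop
    exact (hG.comp this).mul (hk.comp measurable_norm)
  have hG₀s : ∀ (ζ : UnitSphere (d + 1)) (r : ℝ), 0 < r → G₀ (r • ζ.1) = G ζ.1 * k r := by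
    intro ζ r hr
    have : ‖r • ζ.1‖ = r := by
      rw [norm_smul, norm_eq_of_mem_sphere, mul_one, Real.norm_of_nonneg hr.le]
    simp only [G₀, this, smul_smul, inv_mul_cancel₀ hr.ne', one_smul]
  have hgc : Measurable fun η : UnitSphere (d + 1) => G η.1 := hg
  have h1 : ∫⁻ x, G₀ x = (∫⁻ η, G η.1 ∂(surfaceMeasure (d + 1))) * K := by
    rw [lintegral_eq_lintegral_sphere_lintegral_Ioi hG₀,
      ← lintegral_mul_const _ hgc]
    refine lintegral_congr fun ζ => ?_
    rw [← lintegral_const_mul _ (by fun_prop)]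
    refine setLIntegral_congr_fun measurableSet_Ioi fun r hr => ?_
    simp only [hG₀s ζ r hr, Nat.add_sub_cancel]
    ring
  have hsp : ∀ (ζ : UnitSphere d) (r θ : ℝ),
      (WithLp.toLp 2 (Fin.cons (r * Real.cos θ) ((r * Real.sin θ) • ζ.1).ofLp :
        Fin (d + 1) → ℝ) : EuclideanSpace ℝ (Fin (d + 1))) = r • (spherePoint d (θ, ζ)).1 := by
    intro ζ r θ
    ext i
    refine Fin.cases ?_ (fun i => ?_) i
    · simp
    · simp [mul_assoc]
  have hcons : Measurable fun q : (ℝ × ℝ) × UnitSphere d =>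
      (WithLp.toLp 2 (Fin.cons q.1.1 (q.1.2 • q.2.1).ofLp : Fin (d + 1) → ℝ) :
        EuclideanSpace ℝ (Fin (d + 1))) :=
    (measurePreserving_toLp_cons d).measurable.comp
      (g := fun q : ℝ × EuclideanSpace ℝ (Fin d) => _)
      (f := fun q : (ℝ × ℝ) × UnitSphere d => (q.1.1, q.1.2 • q.2.1)) (by fun_prop)
  have hGs : Measurable fun q : ℝ × UnitSphere d => G (spherePoint d q).1 :=
    hg.comp (continuous_spherePoint d).measurable
  have h2 : ∫⁻ x, G₀ x =
      (∫⁻ q, G (spherePoint d q).1 ∂((colatitudeMeasure d).prod (surfaceMeasure d))) * K := by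
    rw [← (measurePreserving_toLp_cons d).lintegral_comp hG₀]
    rw [lintegral_prod (fun q : ℝ × EuclideanSpace ℝ (Fin d) =>
      G₀ (WithLp.toLp 2 (Fin.cons q.1 q.2.ofLp : Fin (d + 1) → ℝ)))
      (hG₀.comp (measurePreserving_toLp_cons d).measurable).aemeasurable]
    have h3 : ∀ t : ℝ, ∫⁻ y : EuclideanSpace ℝ (Fin d),
        G₀ (WithLp.toLp 2 (Fin.cons t y.ofLp : Fin (d + 1) → ℝ)) =
        ∫⁻ ζ : UnitSphere d, ∫⁻ ρ in Set.Ioi (0 : ℝ), ENNReal.ofReal (ρ ^ (d - 1)) *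
          G₀ (WithLp.toLp 2 (Fin.cons t (ρ • ζ.1).ofLp : Fin (d + 1) → ℝ)) ∂volume
            ∂(surfaceMeasure d) := fun t =>
      lintegral_eq_lintegral_sphere_lintegral_Ioi
        (hG₀.comp ((measurePreserving_toLp_cons d).measurable.comp measurable_prodMk_left))
    simp_rw [h3]
    rw [lintegral_lintegral_swap (by
      refine (Measurable.lintegral_prod_right' (f := fun q : (ℝ × UnitSphere d) × ℝ =>
        ENNReal.ofReal (q.2 ^ (d - 1)) *
          G₀ (WithLp.toLp 2 (Fin.cons q.1.1 (q.2 • q.1.2.1).ofLp : Fin (d + 1) → ℝ)))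
            ?_ (ν := volume.restrict (Set.Ioi 0))).aemeasurable
      refine Measurable.mul (by fun_prop) (hG₀.comp (hcons.comp
        (f := fun q : (ℝ × UnitSphere d) × ℝ => ((q.1.1, q.2), q.1.2)) (by fun_prop)))),
      lintegral_prod_symm _ hGs.aemeasurable, ← lintegral_mul_const _ (by
        exact Measurable.lintegral_prod_left' hGs)]
    refine lintegral_congr fun ζ => ?_
    have hmζ : Measurable fun q : ℝ × ℝ => ENNReal.ofReal (q.2 ^ (d - 1)) *
        G₀ (WithLp.toLp 2 (Fin.cons q.1 (q.2 • ζ.1).ofLp : Fin (d + 1) → ℝ)) :=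
      Measurable.mul (by fun_prop) (hG₀.comp (hcons.comp
        (f := fun q : ℝ × ℝ => (q, ζ)) (by fun_prop)))
    rw [lintegral_upper_half_plane hmζ, ← lintegral_const_mul _ (by fun_prop)]
    refine setLIntegral_congr_fun measurableSet_Ioi fun r (hr : 0 < r) => ?_
    have hGζ : Measurable fun θ : ℝ => G (spherePoint d (θ, ζ)).1 :=
      hGs.comp (f := fun θ : ℝ => (θ, ζ)) (by fun_prop)
    beta_reduce
    rw [colatitudeMeasure, lintegral_withDensity_eq_lintegral_mul _ (by fun_prop) hGζ,
      ← lintegral_mul_const _ (by fun_prop)]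
    refine setLIntegral_congr_fun measurableSet_Ioo fun θ hθ => ?_
    have hs : 0 ≤ Real.sin θ := (Real.sin_pos_of_pos_of_lt_pi hθ.1 hθ.2).le
    have hd : d - 1 + 1 = d := Nat.succ_pred_eq_of_ne_zero (NeZero.ne d)
    simp only [hsp, hG₀s _ r hr, Pi.mul_apply]
    rw [mul_pow, ENNReal.ofReal_mul (by positivity)]
    have hrd : ENNReal.ofReal (r ^ d) = ENNReal.ofReal (r ^ (d - 1)) * ENNReal.ofReal r := by
      rw [← ENNReal.ofReal_mul (by positivity), ← pow_succ, hd]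
    rw [hrd]
    ring
  exact ((ENNReal.mul_left_inj hK0 hKt).1 (h1.symm.trans h2)).symm

/-! ### Gaussian integrals of polynomials and the Laplacian on the sphere -/

theorem restrictToSphere_apply {d : ℕ} (q : MvPolynomial (Fin d) ℝ) (ζ : UnitSphere d) :
    restrictToSphere q ζ = MvPolynomial.eval ζ.1.ofLp q := rfl

theorem continuous_restrictToSphere {d : ℕ} (q : MvPolynomial (Fin d) ℝ) :
    Continuous (restrictToSphere q) :=
  (MvPolynomial.continuous_eval q).comp ((PiLp.continuous_ofLp 2 _).comp continuous_subtype_val)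

theorem integrable_restrictToSphere {d : ℕ} (q : MvPolynomial (Fin d) ℝ) :
    Integrable (restrictToSphere q) (surfaceMeasure d) := by
  refine (BoundedContinuousFunction.mkOfCompact
    ⟨restrictToSphere q, continuous_restrictToSphere q⟩).integrable (surfaceMeasure d)

theorem MvPolynomial.IsHomogeneous.eval_smul {σ : Type*} [Fintype σ] {q : MvPolynomial σ ℝ}
    {j : ℕ} (hq : q.IsHomogeneous j) (r : ℝ) (x : σ → ℝ) :
    MvPolynomial.eval (r • x) q = r ^ j * MvPolynomial.eval x q := by
  rw [MvPolynomial.eval_eq', MvPolynomial.eval_eq', Finset.mul_sum]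
  refine Finset.sum_congr rfl fun m hm => ?_
  have hmj : ∑ i, m i = j := by
    rw [← hq (MvPolynomial.mem_support_iff.1 hm), Finsupp.weight_apply, Finsupp.sum_fintype] <;>
      simp
  simp only [Pi.smul_apply, smul_eq_mul, mul_pow, Finset.prod_mul_distrib,
    Finset.prod_pow_eq_pow_sum, hmj]
  ring

theorem integrable_norm_pow_mul_gaussian (d : ℕ) [NeZero d] (k : ℕ) :
    Integrable fun x : EuclideanSpace ℝ (Fin d) => ‖x‖ ^ k * Real.exp (-‖x‖ ^ 2 / 2) := by
  rw [integrable_fun_norm_addHaar volume (f := fun r => r ^ k * Real.exp (-r ^ 2 / 2))]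
  have h := integrableOn_rpow_mul_exp_neg_mul_sq (b := 1 / 2) (by norm_num)
    (s := ((d - 1 + k : ℕ) : ℝ)) (by linarith [Nat.cast_nonneg (α := ℝ) (d - 1 + k)])
  refine h.congr_fun (fun r _ => ?_) measurableSet_Ioi
  simp only [Real.rpow_natCast, finrank_euclideanSpace_fin, smul_eq_mul, pow_add, mul_assoc]
  ring_nf

theorem integrable_eval_mul_gaussian {d : ℕ} [NeZero d] (q : MvPolynomial (Fin d) ℝ) :
    Integrable fun x : EuclideanSpace ℝ (Fin d) =>
      MvPolynomial.eval x.ofLp q * Real.exp (-‖x‖ ^ 2 / 2) := by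
  induction q using MvPolynomial.induction_on' with
  | add p q hp hq => simpa only [map_add, add_mul] using! hp.add hq
  | monomial m a =>
    refine ((integrable_norm_pow_mul_gaussian d (∑ i, m i)).const_mul |a|).mono' ?_
      (.of_forall fun x => ?_)
    · refine Continuous.aestronglyMeasurable ?_
      exact ((MvPolynomial.continuous_eval _).comp (PiLp.continuous_ofLp 2 _)).mul (by fun_prop)
    · rw [MvPolynomial.eval_monomial, Finsupp.prod_fintype _ _ (by simp), norm_mul, norm_mul,
        Real.norm_eq_abs, Real.norm_of_nonneg (Real.exp_pos _).le, norm_prod, mul_assoc]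
      gcongr
      rw [← Finset.prod_pow_eq_pow_sum]
      refine Finset.prod_le_prod (fun _ _ => norm_nonneg _) fun i _ => ?_
      rw [norm_pow]
      gcongr
      exact PiLp.norm_apply_le x i

theorem hasLineDerivAt_eval {d : ℕ} (q : MvPolynomial (Fin d) ℝ) (i : Fin d)
    (x : EuclideanSpace ℝ (Fin d)) :
    HasLineDerivAt ℝ (fun y : EuclideanSpace ℝ (Fin d) => MvPolynomial.eval y.ofLp q)
      (MvPolynomial.eval x.ofLp (MvPolynomial.pderiv i q)) x (EuclideanSpace.single i 1) := by
  induction q using MvPolynomial.induction_on with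
  | C a => simpa [HasLineDerivAt] using hasDerivAt_const (0 : ℝ) a
  | add p q hp hq => simpa only [map_add] using! HasDerivAt.add hp hq
  | mul_X q j hq =>
    have hX : HasDerivAt (fun t : ℝ => (x + t • EuclideanSpace.single i (1 : ℝ)) j)
        (if j = i then 1 else 0) 0 := by
      have := ((hasDerivAt_id (0 : ℝ)).mul_const (if j = i then (1 : ℝ) else 0)).const_add (x j)
      simpa [Pi.single_apply] using this
    have := HasDerivAt.mul hq hX
    simp only [HasLineDerivAt, MvPolynomial.eval_mul, MvPolynomial.eval_X]
    convert! this using 1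
    by_cases hij : j = i
    · subst hij; simp; ring
    · simp [MvPolynomial.pderiv_X_of_ne hij, hij]; ring

theorem hasLineDerivAt_gaussian {d : ℕ} (i : Fin d) (x : EuclideanSpace ℝ (Fin d)) :
    HasLineDerivAt ℝ (fun y : EuclideanSpace ℝ (Fin d) => Real.exp (-‖y‖ ^ 2 / 2))
      (-(x i * Real.exp (-‖x‖ ^ 2 / 2))) x (EuclideanSpace.single i 1) := by
  have h : ∀ t : ℝ, ‖x + t • EuclideanSpace.single i (1 : ℝ)‖ ^ 2 =
      ‖x‖ ^ 2 + 2 * t * x i + t ^ 2 := by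
    intro t
    rw [norm_add_sq_real, inner_smul_right, norm_smul, EuclideanSpace.inner_single_right]
    simp
    ring
  simp only [HasLineDerivAt, h]
  have h1 : HasDerivAt (fun t : ℝ => -(‖x‖ ^ 2 + 2 * t * x i + t ^ 2) / 2) (- x i) 0 := by
    have := ((((((hasDerivAt_id (0 : ℝ)).const_mul 2).mul_const (x i)).const_add (‖x‖ ^ 2)).add
      ((hasDerivAt_id (0 : ℝ)).pow 2)).neg).div_const 2
    convert! this using 1
    simp; ring
  convert! h1.exp using 1
  simp [mul_comm]

/-- Gaussian integration by parts. -/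
theorem integral_pderiv_mul_gaussian {d : ℕ} [NeZero d] (q : MvPolynomial (Fin d) ℝ) (i : Fin d) :
    ∫ x : EuclideanSpace ℝ (Fin d),
        MvPolynomial.eval x.ofLp (MvPolynomial.pderiv i q) * Real.exp (-‖x‖ ^ 2 / 2) =
      ∫ x : EuclideanSpace ℝ (Fin d),
        MvPolynomial.eval x.ofLp (MvPolynomial.X i * q) * Real.exp (-‖x‖ ^ 2 / 2) := by
  have h := integral_bilinear_hasLineDerivAt_right_eq_neg_left_of_integrable
    (μ := (volume : Measure (EuclideanSpace ℝ (Fin d)))) (B := ContinuousLinearMap.mul ℝ ℝ)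
    (f := fun y : EuclideanSpace ℝ (Fin d) => MvPolynomial.eval y.ofLp q)
    (f' := fun y => MvPolynomial.eval y.ofLp (MvPolynomial.pderiv i q))
    (g := fun y : EuclideanSpace ℝ (Fin d) => Real.exp (-‖y‖ ^ 2 / 2))
    (g' := fun y => -(y i * Real.exp (-‖y‖ ^ 2 / 2))) (v := EuclideanSpace.single i 1)
    (integrable_eval_mul_gaussian _)
    (by
      convert! (integrable_eval_mul_gaussian (MvPolynomial.X i * q)).neg using 2
      simp; ring)
    (integrable_eval_mul_gaussian q) (fun x _ => hasLineDerivAt_eval q i x)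
    (fun x _ => hasLineDerivAt_gaussian i x)
  simp only [ContinuousLinearMap.mul_apply'] at h
  rw [← neg_inj, ← h, ← integral_neg]
  congr with x
  simp; ring

/-- Under the Gaussian weight the Laplacian of a form of degree `j` integrates like `j` times the
form: integrate by parts and apply Euler's identity. -/
theorem integral_laplacian_mul_gaussian {d : ℕ} [NeZero d] {q : MvPolynomial (Fin d) ℝ} {j : ℕ}
    (hq : q.IsHomogeneous j) :
    ∫ x : EuclideanSpace ℝ (Fin d),
        MvPolynomial.eval x.ofLp (∑ i, MvPolynomial.pderiv i (MvPolynomial.pderiv i q)) *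
          Real.exp (-‖x‖ ^ 2 / 2) =
      j * ∫ x : EuclideanSpace ℝ (Fin d),
        MvPolynomial.eval x.ofLp q * Real.exp (-‖x‖ ^ 2 / 2) := by
  simp_rw [map_sum, Finset.sum_mul]
  rw [integral_finsetSum _ fun i _ => integrable_eval_mul_gaussian _]
  simp_rw [integral_pderiv_mul_gaussian]
  rw [← integral_finsetSum _ fun i _ => integrable_eval_mul_gaussian _, ← integral_const_mul]
  simp_rw [← Finset.sum_mul, ← map_sum, hq.sum_X_mul_pderiv]
  simp [mul_assoc]

/-- The Gaussian moment `∫₀^∞ r^m e^{-r²/2} dr`. -/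
noncomputable def radialMoment (m : ℕ) : ℝ :=
  ∫ r in Set.Ioi (0 : ℝ), r ^ m * Real.exp (-r ^ 2 / 2)

theorem radialMoment_eq_Gamma (m : ℕ) : radialMoment m =
    (1 / 2 : ℝ) ^ (-((m : ℝ) + 1) / 2) * (1 / 2) * Real.Gamma (((m : ℝ) + 1) / 2) := by
  rw [← integral_rpow_mul_exp_neg_mul_rpow two_pos
    (by linarith [Nat.cast_nonneg (α := ℝ) m]) (by norm_num)]
  refine setIntegral_congr_fun measurableSet_Ioi fun r _ => ?_
  simp only [Real.rpow_natCast, Real.rpow_two]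
  ring_nf

theorem radialMoment_pos (m : ℕ) : 0 < radialMoment m := by
  rw [radialMoment_eq_Gamma]
  have := Real.Gamma_pos_of_pos (s := ((m : ℝ) + 1) / 2) (by positivity)
  positivity

theorem radialMoment_add_two (m : ℕ) : radialMoment (m + 2) = (m + 1) * radialMoment m := by
  rw [radialMoment_eq_Gamma, radialMoment_eq_Gamma]
  have h1 : (((m + 2 : ℕ) : ℝ) + 1) / 2 = ((m : ℝ) + 1) / 2 + 1 := by push_cast; ring
  have h2 : -(((m + 2 : ℕ) : ℝ) + 1) / 2 = -((m : ℝ) + 1) / 2 - 1 := by push_cast; ring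
  rw [h1, h2, Real.Gamma_add_one (by positivity), Real.rpow_sub_one (by norm_num)]
  ring

/-- Polar coordinates split the Gaussian integral of a form into its integral over the sphere and a
radial moment. -/
theorem integral_eval_mul_gaussian {d : ℕ} [NeZero d] {q : MvPolynomial (Fin d) ℝ} {j : ℕ}
    (hq : q.IsHomogeneous j) :
    ∫ x : EuclideanSpace ℝ (Fin d), MvPolynomial.eval x.ofLp q * Real.exp (-‖x‖ ^ 2 / 2) =
      (∫ ζ, restrictToSphere q ζ ∂(surfaceMeasure d)) * radialMoment (d - 1 + j) := by
  have hmp := Measure.measurePreserving_homeomorphUnitSphereProd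
    (volume : Measure (EuclideanSpace ℝ (Fin d)))
  have h0 : MeasurableSet ({0}ᶜ : Set (EuclideanSpace ℝ (Fin d))) :=
    (measurableSet_singleton _).compl
  have h := hmp.integral_comp (Homeomorph.measurableEmbedding _)
    (fun z => restrictToSphere q z.1 * (z.2.1 ^ j * Real.exp (-z.2.1 ^ 2 / 2)))
  rw [integral_prod_mul (fun ζ => restrictToSphere q ζ)
    (fun r : Set.Ioi (0 : ℝ) => r.1 ^ j * Real.exp (-r.1 ^ 2 / 2)), finrank_euclideanSpace_fin] at h
  have hr : ∫ r : Set.Ioi (0 : ℝ), r.1 ^ j * Real.exp (-r.1 ^ 2 / 2)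
      ∂(Measure.volumeIoiPow (d - 1)) = radialMoment (d - 1 + j) := by
    rw [Measure.volumeIoiPow, integral_withDensity_eq_integral_toReal_smul (by fun_prop)
      (.of_forall fun _ => ENNReal.ofReal_lt_top),
      integral_subtype_comap measurableSet_Ioi fun r : ℝ =>
        (ENNReal.ofReal (r ^ (d - 1))).toReal • (r ^ j * Real.exp (-r ^ 2 / 2))]
    refine setIntegral_congr_fun measurableSet_Ioi fun r (hr : 0 < r) => ?_
    simp only [ENNReal.toReal_ofReal (pow_nonneg hr.le _), smul_eq_mul, pow_add, mul_assoc]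
  rw [hr] at h
  have hs : ∫ x : EuclideanSpace ℝ (Fin d),
        MvPolynomial.eval x.ofLp q * Real.exp (-‖x‖ ^ 2 / 2) =
      ∫ x : ({0}ᶜ : Set (EuclideanSpace ℝ (Fin d))),
        MvPolynomial.eval x.1.ofLp q * Real.exp (-‖x.1‖ ^ 2 / 2) ∂(volume.comap Subtype.val) := by
    rw [integral_subtype_comap h0 fun x : EuclideanSpace ℝ (Fin d) =>
      MvPolynomial.eval x.ofLp q * Real.exp (-‖x‖ ^ 2 / 2), restrict_compl_singleton]
  rw [surfaceMeasure, ← h, hs]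
  refine integral_congr_ae (.of_forall fun x => ?_)
  have hx : ‖x.1‖ ≠ 0 := norm_ne_zero_iff.2 x.2
  have hx1 : x.1.ofLp =
      ‖x.1‖ • ((homeomorphUnitSphereProd (EuclideanSpace ℝ (Fin d)) x).1).1.ofLp := by
    simp [smul_smul, hx]
  simp only [homeomorphUnitSphereProd_apply_snd_coe, restrictToSphere_apply]
  rw [hx1, hq.eval_smul]
  ring

/-- Green's formula on the unit ball for a form of degree `j + 2`. -/
theorem integral_restrictToSphere_laplacian {d : ℕ} [NeZero d] {q : MvPolynomial (Fin d) ℝ} {j : ℕ}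
    (hq : q.IsHomogeneous (j + 2)) :
    ∫ ζ, restrictToSphere (∑ i, MvPolynomial.pderiv i (MvPolynomial.pderiv i q)) ζ
        ∂(surfaceMeasure d) =
      (j + 2) * (j + d) * ∫ ζ, restrictToSphere q ζ ∂(surfaceMeasure d) := by
  have hl : (∑ i, MvPolynomial.pderiv i (MvPolynomial.pderiv i q)).IsHomogeneous j :=
    MvPolynomial.IsHomogeneous.sum _ _ _ fun i _ => by
      simpa using (hq.pderiv (i := i)).pderiv (i := i)
  have h := integral_laplacian_mul_gaussian hq
  have hd : ((d - 1 : ℕ) : ℝ) = d - 1 := by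
    rw [Nat.cast_sub (NeZero.one_le), Nat.cast_one]
  rw [integral_eval_mul_gaussian hl, integral_eval_mul_gaussian hq, ← add_assoc,
    radialMoment_add_two] at h
  refine mul_right_cancel₀ (radialMoment_pos (d - 1 + j)).ne' (h.trans ?_)
  push_cast [hd]
  ring

/-- Linear forms have mean zero on the sphere, being harmonic; this includes the sphere of two
points. -/
theorem integral_restrictToSphere_of_isHomogeneous_one {d : ℕ} [NeZero d]
    {q : MvPolynomial (Fin d) ℝ} (hq : q.IsHomogeneous 1) :
    ∫ ζ, restrictToSphere q ζ ∂(surfaceMeasure d) = 0 := by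
  have hl : ∑ i, MvPolynomial.pderiv i (MvPolynomial.pderiv i q) = 0 := by
    refine Finset.sum_eq_zero fun i _ => ?_
    have h0 : (MvPolynomial.pderiv i q).IsHomogeneous 0 := hq.pderiv
    rw [← MvPolynomial.totalDegree_zero_iff_isHomogeneous,
      MvPolynomial.totalDegree_eq_zero_iff_eq_C] at h0
    rw [h0, MvPolynomial.pderiv_C]
  have h := integral_laplacian_mul_gaussian hq
  rw [hl, integral_eval_mul_gaussian hq] at h
  simpa [(radialMoment_pos _).ne'] using h

/-! ### Harmonic forms in one distinguished variable -/

theorem coeff_finSuccEquiv_pderiv_zero {d : ℕ} (H : MvPolynomial (Fin (d + 1)) ℝ) (i : ℕ) :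
    (MvPolynomial.finSuccEquiv ℝ d (MvPolynomial.pderiv 0 H)).coeff i =
      MvPolynomial.C ((i : ℝ) + 1) * (MvPolynomial.finSuccEquiv ℝ d H).coeff (i + 1) := by
  ext m
  have h : m.cons i + Finsupp.single 0 1 = m.cons (i + 1) := by
    ext k
    refine Fin.cases ?_ (fun k => ?_) k <;> simp
  rw [MvPolynomial.finSuccEquiv_coeff_coeff, MvPolynomial.coeff_pderiv, MvPolynomial.coeff_C_mul,
    MvPolynomial.finSuccEquiv_coeff_coeff, h, Finsupp.cons_zero, mul_comm]

theorem coeff_finSuccEquiv_pderiv_succ {d : ℕ} (H : MvPolynomial (Fin (d + 1)) ℝ) (k : Fin d)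
    (i : ℕ) :
    (MvPolynomial.finSuccEquiv ℝ d (MvPolynomial.pderiv k.succ H)).coeff i =
      MvPolynomial.pderiv k ((MvPolynomial.finSuccEquiv ℝ d H).coeff i) := by
  ext m
  have h : m.cons i + Finsupp.single k.succ 1 = (m + Finsupp.single k 1).cons i := by
    ext l
    refine Fin.cases ?_ (fun l => ?_) l
    · simp
    · simp [Finsupp.single_apply]
  rw [MvPolynomial.finSuccEquiv_coeff_coeff, MvPolynomial.coeff_pderiv, MvPolynomial.coeff_pderiv,
    MvPolynomial.finSuccEquiv_coeff_coeff, h, Finsupp.cons_succ]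

/-- Sorting a harmonic polynomial by powers of the first variable, the Laplacian in the other
variables of one coefficient is a multiple of the coefficient two places higher. -/
theorem IsHarmonicPolynomial.laplacian_coeff {d : ℕ} {H : MvPolynomial (Fin (d + 1)) ℝ}
    (hH : IsHarmonicPolynomial H) (i : ℕ) :
    ∑ k, MvPolynomial.pderiv k (MvPolynomial.pderiv k ((MvPolynomial.finSuccEquiv ℝ d H).coeff i)) =
      MvPolynomial.C (-(((i : ℝ) + 2) * (i + 1))) *
        (MvPolynomial.finSuccEquiv ℝ d H).coeff (i + 2) := by
  have h := congrArg (fun q => (MvPolynomial.finSuccEquiv ℝ d q).coeff i) hH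
  simp only [Fin.sum_univ_succ, map_add, map_sum, Polynomial.coeff_add, Polynomial.finsetSum_coeff,
    coeff_finSuccEquiv_pderiv_zero, coeff_finSuccEquiv_pderiv_succ, map_zero, Polynomial.coeff_zero,
    ← mul_assoc] at h
  rw [eq_neg_of_add_eq_zero_right h, MvPolynomial.C_neg, neg_mul]
  simp only [map_add, map_mul, map_natCast, map_one, map_ofNat]
  push_cast
  ring

theorem MvPolynomial.IsHomogeneous.eval_cons_eq_sum {d n : ℕ} {H : MvPolynomial (Fin (d + 1)) ℝ}
    (hH : H.IsHomogeneous n) (t : ℝ) (y : Fin d → ℝ) :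
    MvPolynomial.eval (Fin.cons t y : Fin (d + 1) → ℝ) H = ∑ j ∈ Finset.range (n + 1),
      MvPolynomial.eval y ((MvPolynomial.finSuccEquiv ℝ d H).coeff (n - j)) * t ^ (n - j) := by
  have hdeg : ((MvPolynomial.finSuccEquiv ℝ d H).map (MvPolynomial.eval y)).natDegree < n + 1 := by
    refine Nat.lt_succ_of_le (Polynomial.natDegree_map_le.trans ?_)
    rw [MvPolynomial.natDegree_finSuccEquiv]
    exact (MvPolynomial.degreeOf_le_totalDegree H 0).trans hH.totalDegree_le
  rw [MvPolynomial.eval_eq_eval_mv_eval', Polynomial.eval_eq_sum_range' hdeg,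
    ← Finset.sum_range_reflect]
  simp [Polynomial.coeff_map]

/-- The coefficients `b_j` of the zonal harmonic `∑ b_j x₀^{n-j} ρ^{j/2}`,
`ρ = x₁² + ⋯ + x_d²`, in `d + 1` variables; those of odd index vanish. The denominators are
nonzero for `d ≥ 1`. -/
noncomputable def zonalCoeff (d n : ℕ) : ℕ → ℝ
  | 0 => 1
  | 1 => 0
  | j + 2 => -(((n : ℝ) - j) * (n - j - 1)) / ((j + 2) * (j + d)) * zonalCoeff d n j

theorem zonalCoeff_add_two (d n j : ℕ) [NeZero d] :
    zonalCoeff d n (j + 2) * ((j + 2) * (j + d)) =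
      -(((n : ℝ) - j) * (n - j - 1)) * zonalCoeff d n j := by
  have hd : (0 : ℝ) < d := Nat.cast_pos.2 (NeZero.pos d)
  have : ((j : ℝ) + 2) * (j + d) ≠ 0 := by positivity
  rw [zonalCoeff, mul_right_comm, div_mul_cancel₀ _ this]

theorem zonalCoeff_of_odd (d n : ℕ) {j : ℕ} (hj : ¬ Even j) : zonalCoeff d n j = 0 := by
  induction j using Nat.twoStepInduction with
  | zero => simp at hj
  | one => rfl
  | more j ih _ =>
    rw [zonalCoeff, ih (by simpa [Nat.even_add] using hj), mul_zero]

/-- The mean of a harmonic form over a parallel `{t} × s S^{d-1}` depends on the form only through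
its value at the pole. Each coefficient of the form contributes its mean over `S^{d-1}`, and Green's
formula turns harmonicity into the two-step recursion for these means that defines `zonalCoeff`. -/
theorem IsHarmonicPolynomial.integral_eval_cons {d n : ℕ} [NeZero d]
    {H : MvPolynomial (Fin (d + 1)) ℝ} (hH : IsHarmonicPolynomial H) (hn : H.IsHomogeneous n)
    (t s : ℝ) :
    ∫ ζ : UnitSphere d, MvPolynomial.eval (Fin.cons t (s • ζ.1.ofLp) : Fin (d + 1) → ℝ) H
        ∂(surfaceMeasure d) =
      (surfaceMeasure d).real Set.univ * MvPolynomial.eval (Pi.single 0 1) H *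
        ∑ j ∈ Finset.range (n + 1), zonalCoeff d n j * t ^ (n - j) * s ^ j := by
  -- `q j` is the coefficient of degree `j`, and `a j` is its integral over `S^{d-1}`.
  let q : ℕ → MvPolynomial (Fin d) ℝ := fun j => (MvPolynomial.finSuccEquiv ℝ d H).coeff (n - j)
  have hq : ∀ j ≤ n, (q j).IsHomogeneous j := fun j hj =>
    hn.finSuccEquiv_coeff_isHomogeneous (n - j) j (Nat.sub_add_cancel hj)
  let a : ℕ → ℝ := fun j => ∫ ζ, restrictToSphere (q j) ζ ∂(surfaceMeasure d)
  have hcoeff0 : ∀ y : Fin d → ℝ,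
      MvPolynomial.eval y (q 0) = MvPolynomial.eval (Pi.single 0 1) H := by
    intro y
    have h1 : (Pi.single 0 1 : Fin (d + 1) → ℝ) = Fin.cons 1 ((0 : ℝ) • y) := by
      ext k
      refine Fin.cases ?_ (fun k => ?_) k <;> simp
    rw [h1, hn.eval_cons_eq_sum, Finset.sum_range_succ']
    have h2 : ∀ j ∈ Finset.range n,
        MvPolynomial.eval ((0 : ℝ) • y) (q (j + 1)) * (1 : ℝ) ^ (n - (j + 1)) = 0 := by
      intro j hj
      rw [(hq (j + 1) (by simpa using hj)).eval_smul]
      simp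
    rw [Finset.sum_eq_zero h2]
    have h3 := (hq 0 n.zero_le).eval_smul 0 y
    simp only [pow_zero, one_mul] at h3
    simpa [q] using h3.symm
  have ha : ∀ j ≤ n, a j = (surfaceMeasure d).real Set.univ *
      MvPolynomial.eval (Pi.single 0 1) H * zonalCoeff d n j := by
    intro j
    induction j using Nat.twoStepInduction with
    | zero =>
      intro _
      simp [a, restrictToSphere_apply, hcoeff0, zonalCoeff]
    | one =>
      intro h
      simp [a, integral_restrictToSphere_of_isHomogeneous_one (hq 1 h), zonalCoeff]
    | more j ih _ =>
      intro h
      have hg := integral_restrictToSphere_laplacian (hq (j + 2) h)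
      have hl := hH.laplacian_coeff (n - (j + 2))
      have hc : n - (j + 2) + 2 = n - j := by omega
      have hr : ((n - (j + 2) : ℕ) : ℝ) = n - j - 2 := by
        rw [Nat.cast_sub h]; push_cast; ring
      rw [hc, hr] at hl
      have hg' : ∫ ζ, restrictToSphere (∑ i, MvPolynomial.pderiv i
          (MvPolynomial.pderiv i (q (j + 2)))) ζ ∂(surfaceMeasure d) =
          -(((n : ℝ) - j) * (n - j - 1)) * a j := by
        rw [← integral_const_mul]
        refine integral_congr_ae (.of_forall fun ζ => ?_)
        simp only [restrictToSphere_apply, q, hl, MvPolynomial.eval_mul, MvPolynomial.eval_C]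
        ring
      rw [hg', ih (by omega)] at hg
      have hd : (0 : ℝ) < d := Nat.cast_pos.2 (NeZero.pos d)
      have h0 : ((j : ℝ) + 2) * (j + d) ≠ 0 := by positivity
      refine mul_left_cancel₀ h0 (hg.symm.trans ?_)
      linear_combination (-(surfaceMeasure d).real Set.univ *
        MvPolynomial.eval (Pi.single 0 1) H) * zonalCoeff_add_two d n j
  have hexp : ∀ ζ : UnitSphere d,
      MvPolynomial.eval (Fin.cons t (s • ζ.1.ofLp) : Fin (d + 1) → ℝ) H =
        ∑ j ∈ Finset.range (n + 1), (t ^ (n - j) * s ^ j) * restrictToSphere (q j) ζ := by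
    intro ζ
    rw [hn.eval_cons_eq_sum]
    refine Finset.sum_congr rfl fun j hj => ?_
    have := (hq j (Nat.lt_succ_iff.1 (Finset.mem_range.1 hj))).eval_smul s ζ.1.ofLp
    simp only [q] at this
    rw [this, restrictToSphere_apply]
    ring
  simp_rw [hexp]
  rw [integral_finsetSum _ fun j _ => (integrable_restrictToSphere (q j)).const_mul _,
    Finset.mul_sum]
  refine Finset.sum_congr rfl fun j hj => ?_
  rw [integral_const_mul]
  change _ * a j = _
  rw [ha j (Nat.lt_succ_iff.1 (Finset.mem_range.1 hj))]
  ring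

/-! ### The zonal harmonic and the Legendre polynomial -/

/-- The candidate for the Legendre polynomial of degree `n` in `d + 1` dimensions: the zonal
harmonic with `x₀ = t` and `ρ = 1 - t²`. The exponent `j / 2` is rounded down for odd `j`, where the
coefficient is zero. -/
noncomputable def zonalPolynomial (d n : ℕ) : ℝ[X] :=
  ∑ j ∈ Finset.range (n + 1),
    Polynomial.C (zonalCoeff d n j) * Polynomial.X ^ (n - j) * (1 - Polynomial.X ^ 2) ^ (j / 2)

/-- The squared distance `ρ = x₁² + ⋯ + x_d²` from the axis through `e₁`, in `d + 1` variables
`x₀, …, x_d`. -/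
noncomputable def axisDistSq (d : ℕ) : MvPolynomial (Fin (d + 1)) ℝ :=
  ∑ i : Fin d, MvPolynomial.X i.succ ^ 2

/-- The zonal harmonic of degree `n` in `d + 1` variables, equal to `1` at `e₁`. -/
noncomputable def zonalHarmonic (d n : ℕ) : MvPolynomial (Fin (d + 1)) ℝ :=
  ∑ j ∈ Finset.range (n + 1),
    MvPolynomial.C (zonalCoeff d n j) * (MvPolynomial.X 0 ^ (n - j) * axisDistSq d ^ (j / 2))

theorem zonalHarmonic_isHomogeneous (d n : ℕ) : (zonalHarmonic d n).IsHomogeneous n := by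
  refine MvPolynomial.IsHomogeneous.sum _ _ _ fun j hj => ?_
  by_cases h : Even j
  · have h1 : (axisDistSq d).IsHomogeneous 2 :=
      MvPolynomial.IsHomogeneous.sum _ _ _ fun i _ => MvPolynomial.isHomogeneous_X_pow _ _
    have h2 := ((MvPolynomial.isHomogeneous_X_pow (R := ℝ) (0 : Fin (d + 1)) (n - j)).mul
      (h1.pow (j / 2))).C_mul (zonalCoeff d n j)
    rwa [Nat.two_mul_div_two_of_even h, Nat.sub_add_cancel
      (Nat.lt_succ_iff.1 (Finset.mem_range.1 hj))] at h2
  · simp only [zonalCoeff_of_odd d n h, map_zero, zero_mul]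
    exact MvPolynomial.isHomogeneous_zero _ _ _

theorem pderiv_zero_axisDistSq (d : ℕ) : MvPolynomial.pderiv 0 (axisDistSq d) = 0 := by
  simp [axisDistSq]

theorem pderiv_succ_axisDistSq {d : ℕ} (i : Fin d) :
    MvPolynomial.pderiv i.succ (axisDistSq d) = 2 * MvPolynomial.X i.succ := by
  simp [axisDistSq, MvPolynomial.pderiv_X, Pi.single_apply]

theorem laplacian_X_pow_mul_axisDistSq_pow (d a k : ℕ) :
    ∑ i : Fin (d + 1), MvPolynomial.pderiv i (MvPolynomial.pderiv i
        (MvPolynomial.X 0 ^ a * axisDistSq d ^ k : MvPolynomial (Fin (d + 1)) ℝ)) =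
      MvPolynomial.C ((a : ℝ) * (a - 1)) * (MvPolynomial.X 0 ^ (a - 2) * axisDistSq d ^ k) +
      MvPolynomial.C (2 * (k : ℝ) * (2 * (k - 1) + d)) *
        (MvPolynomial.X 0 ^ a * axisDistSq d ^ (k - 1)) := by
  have h0 : MvPolynomial.pderiv 0 (MvPolynomial.pderiv 0
        (MvPolynomial.X 0 ^ a * axisDistSq d ^ k : MvPolynomial (Fin (d + 1)) ℝ)) =
      MvPolynomial.C ((a : ℝ) * (a - 1)) * (MvPolynomial.X 0 ^ (a - 2) * axisDistSq d ^ k) := by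
    simp only [MvPolynomial.pderiv_mul, MvPolynomial.pderiv_pow, pderiv_zero_axisDistSq,
      MvPolynomial.pderiv_X_self, Derivation.map_natCast, mul_zero, add_zero, mul_one, zero_mul,
      zero_add]
    rcases a with _ | a
    · simp
    · simp only [map_mul, map_sub, map_natCast, map_one, Nat.add_sub_cancel]
      push_cast
      ring
  have h1 : ∀ i : Fin d, MvPolynomial.pderiv i.succ (MvPolynomial.pderiv i.succ
        (MvPolynomial.X 0 ^ a * axisDistSq d ^ k : MvPolynomial (Fin (d + 1)) ℝ)) =
      MvPolynomial.X 0 ^ a * (MvPolynomial.C (2 * (k : ℝ)) * axisDistSq d ^ (k - 1) +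
        MvPolynomial.C (4 * (k : ℝ) * (k - 1)) * axisDistSq d ^ (k - 2) *
          MvPolynomial.X i.succ ^ 2) := by
    intro i
    have hX : MvPolynomial.pderiv i.succ (MvPolynomial.X 0 : MvPolynomial (Fin (d + 1)) ℝ) = 0 :=
      MvPolynomial.pderiv_X_of_ne (Fin.succ_ne_zero i).symm
    have h2 : MvPolynomial.pderiv i.succ (2 : MvPolynomial (Fin (d + 1)) ℝ) = 0 :=
      Derivation.map_natCast _ 2
    simp only [MvPolynomial.pderiv_mul, MvPolynomial.pderiv_pow, pderiv_succ_axisDistSq,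
      MvPolynomial.pderiv_X_self, Derivation.map_natCast, hX, h2, mul_zero, mul_one,
      zero_mul, zero_add]
    rcases k with _ | k
    · simp
    · simp only [map_mul, map_sub, map_natCast, map_one, map_ofNat, Nat.add_sub_cancel]
      push_cast
      ring
  rw [Fin.sum_univ_succ, h0]
  simp_rw [h1]
  rw [← Finset.mul_sum, Finset.sum_add_distrib, ← Finset.mul_sum, Finset.sum_const,
    Finset.card_univ, Fintype.card_fin, nsmul_eq_mul]
  congr 1
  have hk : MvPolynomial.C (4 * (k : ℝ) * (k - 1)) * axisDistSq d ^ (k - 2) * axisDistSq d =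
      MvPolynomial.C (4 * (k : ℝ) * (k - 1)) * axisDistSq d ^ (k - 1) := by
    rcases k with _ | _ | k
    · simp
    · simp
    · rw [mul_assoc, ← pow_succ]
      rfl
  rw [← Finset.mul_sum, show ∑ i : Fin d, MvPolynomial.X i.succ ^ 2 = axisDistSq d from rfl, hk]
  simp only [map_mul, map_add, map_sub, map_natCast, map_one, map_ofNat]
  ring

theorem zonalHarmonic_isHarmonicPolynomial (d n : ℕ) [NeZero d] :
    IsHarmonicPolynomial (zonalHarmonic d n) := by
  -- `U j` and `V j` are the second derivative along the axis and the Laplacian across it of the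
  -- `j`-th term; by the recursion for the coefficients `V (j + 2)` cancels `U j`.
  let U : ℕ → MvPolynomial (Fin (d + 1)) ℝ := fun j =>
    MvPolynomial.C (((n : ℝ) - j) * (n - j - 1) * zonalCoeff d n j) *
      (MvPolynomial.X 0 ^ (n - j - 2) * axisDistSq d ^ (j / 2))
  let V : ℕ → MvPolynomial (Fin (d + 1)) ℝ := fun j =>
    MvPolynomial.C ((j : ℝ) * (j - 2 + d) * zonalCoeff d n j) *
      (MvPolynomial.X 0 ^ (n - j) * axisDistSq d ^ (j / 2 - 1))
  have hUV : ∀ j ∈ Finset.range (n + 1), ∑ i : Fin (d + 1), MvPolynomial.pderiv i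
      (MvPolynomial.pderiv i (MvPolynomial.C (zonalCoeff d n j) *
        (MvPolynomial.X 0 ^ (n - j) * axisDistSq d ^ (j / 2)))) = U j + V j := by
    intro j hj
    by_cases h : Even j
    · simp_rw [MvPolynomial.pderiv_C_mul]
      rw [← Finset.mul_sum, laplacian_X_pow_mul_axisDistSq_pow, mul_add,
        ← mul_assoc (MvPolynomial.C _) (MvPolynomial.C _),
        ← mul_assoc (MvPolynomial.C _) (MvPolynomial.C _),
        ← MvPolynomial.C_mul, ← MvPolynomial.C_mul,
        Nat.cast_sub (Nat.lt_succ_iff.1 (Finset.mem_range.1 hj)),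
        Nat.cast_div h.two_dvd (by norm_num)]
      simp only [U, V]
      congr 3
      · ring
      · push_cast; ring
    · simp [U, V, zonalCoeff_of_odd d n h]
  have hVU : ∀ j, V (j + 2) = -U j := by
    intro j
    simp only [U, V]
    rw [← neg_mul, ← MvPolynomial.C_neg, show (j + 2) / 2 - 1 = j / 2 by omega, Nat.sub_add_eq]
    congr 2
    push_cast
    linear_combination zonalCoeff_add_two d n j
  have hV0 : V 0 = 0 := by simp [V]
  have hV1 : V 1 = 0 := by simp [V, zonalCoeff]
  have hUn : U n = 0 := by simp [U]
  unfold IsHarmonicPolynomial zonalHarmonic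
  simp_rw [map_sum]
  rw [Finset.sum_comm, Finset.sum_congr rfl hUV, Finset.sum_add_distrib, Finset.sum_range_succ, hUn,
    Finset.sum_range_succ', hV0, add_zero, add_zero]
  rcases n with _ | m
  · simp
  · have hUm : U m = 0 := by simp [U]
    rw [Finset.sum_range_succ, hUm, Finset.sum_range_succ', hV1, add_zero, add_zero,
      ← Finset.sum_add_distrib]
    exact Finset.sum_eq_zero fun j _ => by rw [hVU, add_neg_cancel]

theorem eval_zonalPolynomial {d n : ℕ} {t s : ℝ} (h : t ^ 2 + s ^ 2 = 1) :
    (zonalPolynomial d n).eval t =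
      ∑ j ∈ Finset.range (n + 1), zonalCoeff d n j * t ^ (n - j) * s ^ j := by
  rw [zonalPolynomial, Polynomial.eval_finsetSum]
  refine Finset.sum_congr rfl fun j _ => ?_
  by_cases hj : Even j
  · have hs : 1 - t ^ 2 = s ^ 2 := by linarith
    simp [hs, ← pow_mul, Nat.two_mul_div_two_of_even hj]
  · simp [zonalCoeff_of_odd d n hj]

theorem eval_axisDistSq {d : ℕ} (x : Fin (d + 1) → ℝ) :
    MvPolynomial.eval x (axisDistSq d) = x ⬝ᵥ x - x 0 ^ 2 := by
  simp [axisDistSq, dotProduct, Fin.sum_univ_succ, pow_two]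

theorem isLegendrePolynomial_zonalPolynomial (d n : ℕ) [NeZero d] :
    IsLegendrePolynomial (d + 1) n (zonalPolynomial d n) := by
  refine ⟨zonalHarmonic d n, zonalHarmonic_isHomogeneous d n,
    zonalHarmonic_isHarmonicPolynomial d n, ?_, fun R hR hRe x => ?_, fun ξ => ?_⟩
  · rw [zonalHarmonic, map_sum, Finset.sum_eq_single_of_mem 0 (by simp)]
    · simp [zonalCoeff]
    · intro j _ hj
      by_cases hj2 : Even j
      · have : j / 2 ≠ 0 := by
          obtain ⟨k, rfl⟩ := hj2
          omega
        simp [eval_axisDistSq, this]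
      · simp [zonalCoeff_of_odd d n hj2]
  -- `R` fixes `e₁` and preserves the dot product, hence it preserves `x₀` and `ρ`.
  · have hRR : Rᵀ * R = 1 := by
      simpa [Matrix.star_eq_conjTranspose] using (Matrix.mem_orthogonalGroup_iff' _ _).1 hR
    have h0 : (R *ᵥ x) 0 = x 0 := by
      rw [← single_one_dotProduct (i := (0 : Fin (d + 1))) (R *ᵥ x)]
      nth_rewrite 1 [← hRe]
      rw [Matrix.dotProduct_mulVec, Matrix.vecMul_mulVec, hRR]
      simp
    have h1 : (R *ᵥ x) ⬝ᵥ (R *ᵥ x) = x ⬝ᵥ x := by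
      rw [Matrix.dotProduct_mulVec, Matrix.vecMul_mulVec, hRR]
      simp
    simp only [zonalHarmonic, map_sum, MvPolynomial.eval_mul, MvPolynomial.eval_C,
      MvPolynomial.eval_pow, MvPolynomial.eval_X, eval_axisDistSq, h0, h1]
  · have h1 : ξ.1.ofLp ⬝ᵥ ξ.1.ofLp = 1 := by
      have := EuclideanSpace.real_norm_sq_eq ξ.1
      rw [norm_eq_of_mem_sphere, one_pow] at this
      simp [dotProduct, ← pow_two, ← this]
    simp [restrictToSphere_apply, zonalHarmonic, zonalPolynomial, eval_axisDistSq, h1,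
      Polynomial.eval_finsetSum, EuclideanSpace.inner_single_right, mul_assoc]

theorem eval_spherePoint {d : ℕ} (q : MvPolynomial (Fin (d + 1)) ℝ) (θ : ℝ) (ζ : UnitSphere d) :
    restrictToSphere q (spherePoint d (θ, ζ)) =
      MvPolynomial.eval (Fin.cons (Real.cos θ) (Real.sin θ • ζ.1.ofLp) : Fin (d + 1) → ℝ) q :=
  rfl

theorem surfaceMeasure_real_univ_ne_zero (d : ℕ) [NeZero d] :
    (surfaceMeasure d).real Set.univ ≠ 0 := by
  rw [Ne, measureReal_eq_zero_iff, Measure.measure_univ_eq_zero]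
  exact Measure.toSphere_ne_zero _

/-- The mean of a spherical harmonic over the parallel of colatitude `θ` about `e₁`. -/
theorem integral_restrictToSphere_spherePoint {d n : ℕ} [NeZero d]
    {H : MvPolynomial (Fin (d + 1)) ℝ} (hH : IsHarmonicPolynomial H) (hn : H.IsHomogeneous n)
    (θ : ℝ) :
    ∫ ζ, restrictToSphere H (spherePoint d (θ, ζ)) ∂(surfaceMeasure d) =
      (surfaceMeasure d).real Set.univ * MvPolynomial.eval (Pi.single 0 1) H *
        (zonalPolynomial d n).eval (Real.cos θ) := by
  simp_rw [eval_spherePoint]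
  rw [hH.integral_eval_cons hn, eval_zonalPolynomial (Real.cos_sq_add_sin_sq θ)]

/-- The Legendre polynomial is unique, since the mean of `L` over a parallel is on the one hand the
value of `P` there, on the other hand given by `integral_restrictToSphere_spherePoint`. -/
theorem IsLegendrePolynomial.eq_zonalPolynomial {d n : ℕ} [NeZero d] {P : ℝ[X]}
    (hP : IsLegendrePolynomial (d + 1) n P) : P = zonalPolynomial d n := by
  obtain ⟨L, hn, hL, h1, -, hLP⟩ := hP
  have h : ∀ t ∈ Set.Icc (-1 : ℝ) 1, P.eval t = (zonalPolynomial d n).eval t := by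
    intro t ht
    rw [← Real.cos_arccos ht.1 ht.2]
    have := integral_restrictToSphere_spherePoint hL hn (Real.arccos t)
    simp only [hLP, EuclideanSpace.inner_single_right, spherePoint_zero, h1] at this
    simpa [surfaceMeasure_real_univ_ne_zero] using this
  exact Polynomial.eq_of_infinite_eval_eq _ _ ((Set.Icc_infinite (by norm_num)).mono h)

/-! ### Rotations -/

theorem MvPolynomial.pderiv_aeval {σ τ : Type*} [Fintype σ] (g : σ → MvPolynomial τ ℝ)
    (q : MvPolynomial σ ℝ) (i : τ) :
    MvPolynomial.pderiv i (MvPolynomial.aeval g q) =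
      ∑ k, MvPolynomial.aeval g (MvPolynomial.pderiv k q) * MvPolynomial.pderiv i (g k) := by
  classical
  induction q using MvPolynomial.induction_on with
  | C a => simp [MvPolynomial.algebraMap_eq]
  | add p q hp hq => simp only [map_add, hp, hq, add_mul, Finset.sum_add_distrib]
  | mul_X q j hq =>
    simp only [map_mul, MvPolynomial.pderiv_mul, hq, MvPolynomial.aeval_X, map_add, add_mul,
      Finset.sum_add_distrib, Finset.sum_mul, MvPolynomial.pderiv_X, Pi.single_apply]
    congr 1
    · exact Finset.sum_congr rfl fun k _ => by ring
    · simp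

/-- Harmonic forms are carried to harmonic forms by linear isometries. -/
theorem IsHarmonicPolynomial.exists_comp_isometry {p n : ℕ} {H : MvPolynomial (Fin p) ℝ}
    (hH : IsHarmonicPolynomial H) (hn : H.IsHomogeneous n)
    (T : EuclideanSpace ℝ (Fin p) ≃ₗᵢ[ℝ] EuclideanSpace ℝ (Fin p)) :
    ∃ H' : MvPolynomial (Fin p) ℝ, H'.IsHomogeneous n ∧ IsHarmonicPolynomial H' ∧
      ∀ x : EuclideanSpace ℝ (Fin p),
        MvPolynomial.eval x.ofLp H' = MvPolynomial.eval (T x).ofLp H := by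
  let R : Fin p → EuclideanSpace ℝ (Fin p) := fun k => T.symm (EuclideanSpace.single k 1)
  let g : Fin p → MvPolynomial (Fin p) ℝ := fun k =>
    ∑ i, MvPolynomial.C (R k i) * MvPolynomial.X i
  have hR : ∀ k l, ∑ i, R l i * R k i = if k = l then 1 else 0 := by
    intro k l
    have : inner ℝ (R k) (R l) = if k = l then 1 else 0 := by
      rw [LinearIsometryEquiv.inner_map_map, EuclideanSpace.inner_single_left]
      simp
    simpa [PiLp.inner_apply] using this
  have hg : ∀ i k, MvPolynomial.pderiv i (g k) = MvPolynomial.C (R k i) := by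
    intro i k
    simp [g, MvPolynomial.pderiv_X, Pi.single_apply]
  refine ⟨MvPolynomial.aeval g H, ?_, ?_, fun x => ?_⟩
  · simpa using hn.aeval g (n := 1) fun k =>
      MvPolynomial.IsHomogeneous.sum _ _ _ fun i _ => (MvPolynomial.isHomogeneous_X _ _).C_mul _
  · have h1 : ∀ i, MvPolynomial.pderiv i (MvPolynomial.pderiv i (MvPolynomial.aeval g H)) =
        ∑ k, ∑ l, MvPolynomial.aeval g (MvPolynomial.pderiv l (MvPolynomial.pderiv k H)) *
          MvPolynomial.C (R l i * R k i) := by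
      intro i
      simp only [MvPolynomial.pderiv_aeval, hg, map_sum, MvPolynomial.pderiv_mul,
        MvPolynomial.pderiv_C, mul_zero, add_zero, Finset.sum_mul, MvPolynomial.C_mul, mul_assoc]
    unfold IsHarmonicPolynomial
    simp_rw [h1]
    rw [Finset.sum_comm]
    have h2 : ∀ k, ∑ i, ∑ l, MvPolynomial.aeval g
        (MvPolynomial.pderiv l (MvPolynomial.pderiv k H)) * MvPolynomial.C (R l i * R k i) =
        MvPolynomial.aeval g (MvPolynomial.pderiv k (MvPolynomial.pderiv k H)) := by
      intro k
      rw [Finset.sum_comm]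
      simp_rw [← Finset.mul_sum, ← map_sum, hR]
      simp
    simp_rw [h2]
    rw [← map_sum, hH, map_zero]
  · have hx : ∀ k, MvPolynomial.eval x.ofLp (g k) = T x k := by
      intro k
      have h1 : T x k = inner ℝ (EuclideanSpace.single k (1 : ℝ)) (T x) := by
        rw [EuclideanSpace.inner_single_left]; simp
      have h2 : inner ℝ (EuclideanSpace.single k (1 : ℝ)) (T x) = inner ℝ (R k) x := by
        rw [← T.inner_map_map (R k) x, T.apply_symm_apply]
      rw [h1, h2]
      simp [g, PiLp.inner_apply, mul_comm]
    have : MvPolynomial.eval x.ofLp (MvPolynomial.aeval g H) =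
        MvPolynomial.eval (fun k => MvPolynomial.eval x.ofLp (g k)) H := by
      rw [← MvPolynomial.coe_aeval_eq_eval, ← MvPolynomial.coe_aeval_eq_eval]
      simp only [RingHom.coe_coe]
      rw [← AlgHom.comp_apply, MvPolynomial.comp_aeval]
    rw [this, _root_.funext hx]

/-- The action of a linear isometry on the unit sphere. -/
noncomputable def sphereIsometry {p : ℕ}
    (T : EuclideanSpace ℝ (Fin p) ≃ₗᵢ[ℝ] EuclideanSpace ℝ (Fin p)) (η : UnitSphere p) :
    UnitSphere p :=
  ⟨T η.1, by simp⟩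

open scoped Pointwise in
theorem measurePreserving_sphereIsometry {p : ℕ}
    (T : EuclideanSpace ℝ (Fin p) ≃ₗᵢ[ℝ] EuclideanSpace ℝ (Fin p)) :
    MeasurePreserving (sphereIsometry T) (surfaceMeasure p) (surfaceMeasure p) := by
  have hc : Continuous (sphereIsometry T) :=
    (T.continuous.comp continuous_subtype_val).subtype_mk _
  refine ⟨hc.measurable, Measure.ext fun s hs => ?_⟩
  have hT : ∀ B : Set (EuclideanSpace ℝ (Fin p)), volume (T ⁻¹' B) = volume B :=
    T.measurePreserving.measure_preimage_equiv (f := T.toHomeomorph.toMeasurableEquiv)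
  rw [Measure.map_apply hc.measurable hs, surfaceMeasure,
    Measure.toSphere_apply' _ (hc.measurable hs), Measure.toSphere_apply' _ hs,
    ← hT (Set.Ioo (0 : ℝ) 1 • (Subtype.val '' s))]
  congr 2
  ext x
  simp only [Set.mem_preimage, Set.mem_smul, Set.mem_image]
  constructor
  · rintro ⟨r, hr, _, ⟨ζ, hζ, rfl⟩, rfl⟩
    exact ⟨r, hr, _, ⟨_, hζ, rfl⟩, by simp [sphereIsometry]⟩
  · rintro ⟨r, hr, _, ⟨ζ, hζ, rfl⟩, h⟩
    refine ⟨r, hr, _, ⟨sphereIsometry T.symm ζ, ?_, rfl⟩, ?_⟩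
    · have : sphereIsometry T (sphereIsometry T.symm ζ) = ζ := by
        ext1; simp [sphereIsometry]
      simpa [this] using hζ
    · apply T.injective
      simpa [sphereIsometry] using h

/-! ### The substitution `t = cos θ` -/

theorem image_cos_Ioo : Real.cos '' Set.Ioo 0 Real.pi = Set.Ioo (-1) 1 := by
  ext t
  constructor
  · rintro ⟨θ, hθ, rfl⟩
    have hs := Real.sin_pos_of_pos_of_lt_pi hθ.1 hθ.2
    have := Real.cos_sq_add_sin_sq θ
    constructor <;> nlinarith
  · intro ht
    exact ⟨Real.arccos t, ⟨Real.arccos_pos.2 ht.2, Real.arccos_lt_pi.2 ht.1⟩,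
      Real.cos_arccos ht.1.le ht.2.le⟩

/-- The substitution `t = cos θ` carries the weight `(1 - t²)^{(p-3)/2} dt` with `p = d + 1` to
`sin^{d-1} θ dθ`. -/
theorem abs_deriv_cos_smul_weight {d : ℕ} [NeZero d] (g : ℝ → ℝ) {θ : ℝ}
    (hθ : θ ∈ Set.Ioo 0 Real.pi) :
    |-Real.sin θ| • (g (Real.cos θ) * (1 - Real.cos θ ^ 2) ^ (((d + 1 : ℕ) - 3 : ℝ) / 2)) =
      (ENNReal.ofReal (Real.sin θ ^ (d - 1))).toReal • g (Real.cos θ) := by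
  have hs := Real.sin_pos_of_pos_of_lt_pi hθ.1 hθ.2
  have hd : ((d - 1 : ℕ) : ℝ) = d - 1 := by
    rw [Nat.cast_sub (NeZero.one_le), Nat.cast_one]
  have hpow : Real.sin θ * (1 - Real.cos θ ^ 2) ^ (((d + 1 : ℕ) - 3 : ℝ) / 2) =
      Real.sin θ ^ (d - 1) := by
    rw [← Real.sin_sq, ← Real.rpow_natCast (Real.sin θ) 2, ← Real.rpow_mul hs.le,
      ← Real.rpow_natCast (Real.sin θ) (d - 1), hd]
    nth_rewrite 1 [← Real.rpow_one (Real.sin θ)]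
    rw [← Real.rpow_add hs]
    congr 1
    push_cast
    ring
  rw [ENNReal.toReal_ofReal (by positivity), abs_neg, abs_of_pos hs, ← hpow]
  simp only [smul_eq_mul]
  ring

theorem intervalIntegrable_weight_iff {d : ℕ} [NeZero d] (g : ℝ → ℝ) :
    IntervalIntegrable (fun t : ℝ => g t * (1 - t ^ 2) ^ (((d + 1 : ℕ) - 3 : ℝ) / 2))
        volume (-1) 1 ↔
      Integrable (fun θ => g (Real.cos θ)) (colatitudeMeasure d) := by
  rw [intervalIntegrable_iff_integrableOn_Ioo_of_le (by norm_num), ← image_cos_Ioo,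
    integrableOn_image_iff_integrableOn_abs_deriv_smul measurableSet_Ioo
      (fun θ _ => (Real.hasDerivAt_cos θ).hasDerivWithinAt)
      (Real.injOn_cos.mono Set.Ioo_subset_Icc_self), colatitudeMeasure,
    integrable_withDensity_iff_integrable_smul' (by fun_prop)
      (.of_forall fun _ => ENNReal.ofReal_lt_top)]
  exact integrableOn_congr_fun (fun θ hθ => abs_deriv_cos_smul_weight g hθ) measurableSet_Ioo

theorem intervalIntegral_weight {d : ℕ} [NeZero d] (g : ℝ → ℝ) :
    ∫ t in (-1 : ℝ)..1, g t * (1 - t ^ 2) ^ (((d + 1 : ℕ) - 3 : ℝ) / 2) =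
      ∫ θ, g (Real.cos θ) ∂(colatitudeMeasure d) := by
  rw [intervalIntegral.integral_of_le (by norm_num), integral_Ioc_eq_integral_Ioo, ← image_cos_Ioo,
    integral_image_eq_integral_abs_deriv_smul measurableSet_Ioo
      (fun θ _ => (Real.hasDerivAt_cos θ).hasDerivWithinAt)
      (Real.injOn_cos.mono Set.Ioo_subset_Icc_self), colatitudeMeasure,
    integral_withDensity_eq_integral_toReal_smul (by fun_prop)
      (.of_forall fun _ => ENNReal.ofReal_lt_top)]
  exact setIntegral_congr_fun measurableSet_Ioo fun θ hθ => abs_deriv_cos_smul_weight g hθ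

/-! ### The Hecke–Funk theorem -/

theorem exists_isometry_single_eq {d : ℕ} (ξ : UnitSphere (d + 1)) :
    ∃ T : EuclideanSpace ℝ (Fin (d + 1)) ≃ₗᵢ[ℝ] EuclideanSpace ℝ (Fin (d + 1)),
      T (EuclideanSpace.single 0 1) = ξ.1 :=
  ⟨_, Submodule.reflection_sub (by simp)⟩

/-- Sampling the sphere by `Ψ`, the colatitude about `ξ` is distributed as `colatitudeMeasure`, so a
zonal function on the sphere is integrable as soon as it is integrable in the colatitude. -/
theorem integrable_comp_inner {d : ℕ} {f : ℝ → ℝ} {ξ : UnitSphere (d + 1)}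
    {Ψ : ℝ × UnitSphere d → UnitSphere (d + 1)}
    (hΨ : MeasurePreserving Ψ ((colatitudeMeasure d).prod (surfaceMeasure d))
      (surfaceMeasure (d + 1)))
    (hinner : ∀ q, inner ℝ ξ.1 (Ψ q).1 = Real.cos q.1)
    (hf : Integrable (fun θ => f (Real.cos θ)) (colatitudeMeasure d)) :
    Integrable (fun η : UnitSphere (d + 1) => f (inner ℝ ξ.1 η.1)) (surfaceMeasure (d + 1)) := by
  let A : UnitSphere (d + 1) → ℝ := fun η => Real.arccos (inner ℝ ξ.1 η.1)
  have hA : Measurable A := by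
    have : Continuous fun η : UnitSphere (d + 1) => inner ℝ ξ.1 η.1 := by fun_prop
    exact Real.continuous_arccos.measurable.comp this.measurable
  have hae : ∀ᵐ θ ∂(colatitudeMeasure d), Real.arccos (Real.cos θ) = θ := by
    refine (withDensity_absolutelyContinuous _ _).ae_le ?_
    filter_upwards [ae_restrict_mem measurableSet_Ioo] with θ hθ
    exact Real.arccos_cos hθ.1.le hθ.2.le
  have hmap : (surfaceMeasure (d + 1)).map A =
      surfaceMeasure d Set.univ • colatitudeMeasure d := by
    rw [← hΨ.map_eq, Measure.map_map hA hΨ.measurable, ← Measure.map_fst_prod]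
    refine Measure.map_congr ?_
    filter_upwards [Measure.quasiMeasurePreserving_fst.ae hae] with q hq
    simp only [A, Function.comp_apply, hinner, hq]
  have hfA : Integrable (fun θ => f (Real.cos θ)) ((surfaceMeasure (d + 1)).map A) := by
    rw [hmap]
    exact hf.smul_measure (measure_ne_top _ _)
  refine (hfA.comp_measurable hA).congr (.of_forall fun η => ?_)
  have := abs_real_inner_le_norm ξ.1 η.1
  rw [norm_eq_of_mem_sphere, norm_eq_of_mem_sphere, mul_one, abs_le] at this
  simp only [A, Function.comp_apply, Real.cos_arccos this.1 this.2]

theorem mainTheorem7 (p : ℕ) [NeZero p] (hp : 2 ≤ p) (n : ℕ) :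
    (∃! P : ℝ[X], IsLegendrePolynomial p n P) ∧
    ∀ P : ℝ[X], IsLegendrePolynomial p n P →
      ∀ Y : UnitSphere p → ℝ, IsSphericalHarmonic n Y →
        ∀ (ξ : UnitSphere p) (f : ℝ → ℝ),
          (IntervalIntegrable
              (fun t : ℝ => f t * (1 - t ^ 2) ^ (((p : ℝ) - 3) / 2)) volume (-1) 1 →
            Integrable (fun η : UnitSphere p => f (inner ℝ ξ.1 η.1) * Y η) (surfaceMeasure p) ∧
            IntervalIntegrable
              (fun t : ℝ => f t * P.eval t * (1 - t ^ 2) ^ (((p : ℝ) - 3) / 2))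
              volume (-1) 1) ∧
          (Integrable (fun η : UnitSphere p => f (inner ℝ ξ.1 η.1) * Y η) (surfaceMeasure p) →
            (Y ξ ≠ 0 →
              IntervalIntegrable
                (fun t : ℝ => f t * P.eval t * (1 - t ^ 2) ^ (((p : ℝ) - 3) / 2))
                volume (-1) 1) ∧
            ∫ η : UnitSphere p, f (inner ℝ ξ.1 η.1) * Y η ∂(surfaceMeasure p) =
              sphereArea (p - 2) * Y ξ *
                ∫ t in (-1 : ℝ)..1, f t * P.eval t * (1 - t ^ 2) ^ (((p : ℝ) - 3) / 2)) := by
  obtain ⟨k, rfl⟩ := Nat.exists_eq_add_of_le' hp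
  rw [show sphereArea (k + 2 - 2) = (surfaceMeasure (k + 1)).real Set.univ from rfl]
  refine ⟨⟨_, isLegendrePolynomial_zonalPolynomial (k + 1) n, fun P hP => hP.eq_zonalPolynomial⟩,
    fun P hP Y hY ξ f => ?_⟩
  obtain rfl := hP.eq_zonalPolynomial
  obtain ⟨H, hn, hH, rfl⟩ := hY
  -- After a rotation `ξ` is the pole `e₁`, and `Ψ = T ∘ spherePoint` slices the sphere about `ξ`.
  obtain ⟨T, hT⟩ := exists_isometry_single_eq ξ
  obtain ⟨H', hn', hH', hHT⟩ := hH.exists_comp_isometry hn T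
  have hΨ : MeasurePreserving (sphereIsometry T ∘ spherePoint (k + 1))
      ((colatitudeMeasure (k + 1)).prod (surfaceMeasure (k + 1))) (surfaceMeasure (k + 2)) :=
    (measurePreserving_sphereIsometry T).comp (measurePreserving_spherePoint (k + 1))
  have hinner : ∀ q, inner ℝ ξ.1 ((sphereIsometry T ∘ spherePoint (k + 1)) q).1 =
      Real.cos q.1 := by
    intro q
    rw [← hT]
    simp [sphereIsometry, EuclideanSpace.inner_single_left]
  have hY : ∀ q, restrictToSphere H ((sphereIsometry T ∘ spherePoint (k + 1)) q) =
      restrictToSphere H' (spherePoint (k + 1) q) := fun q => (hHT _).symm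
  have hYξ : MvPolynomial.eval (Pi.single 0 1) H' = restrictToSphere H ξ := by
    have := hHT (EuclideanSpace.single 0 1)
    rw [hT] at this
    simpa using! this
  constructor
  · intro hf
    have hf' := (intervalIntegrable_weight_iff (d := k + 1) f).1 hf
    constructor
    · obtain ⟨C, hC⟩ := isCompact_univ.exists_bound_of_continuousOn
        (continuous_restrictToSphere H).continuousOn
      exact (integrable_comp_inner hΨ hinner hf').mul_bdd
        (continuous_restrictToSphere H).aestronglyMeasurable
        (.of_forall fun η => hC η (Set.mem_univ η))
    · obtain ⟨C, hC⟩ := isCompact_Icc.exists_bound_of_continuousOn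
        ((zonalPolynomial (k + 1) n).continuous.continuousOn (s := Set.Icc (-1) 1))
      refine (intervalIntegrable_weight_iff (d := k + 1)
        fun t => f t * (zonalPolynomial (k + 1) n).eval t).2 ?_
      exact hf'.mul_bdd
        ((zonalPolynomial (k + 1) n).continuous.comp Real.continuous_cos).aestronglyMeasurable
        (.of_forall fun θ => hC _ (Real.cos_mem_Icc θ))
  · intro hF
    have hF' : Integrable (fun q : ℝ × UnitSphere (k + 1) =>
        f (Real.cos q.1) * restrictToSphere H' (spherePoint (k + 1) q))
        ((colatitudeMeasure (k + 1)).prod (surfaceMeasure (k + 1))) := by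
      refine (hΨ.integrable_comp_of_integrable hF).congr (.of_forall fun q => ?_)
      simp only [Function.comp_apply (f := fun η : UnitSphere (k + 2) => _ * _), hinner, hY]
    have hmean : ∀ θ, ∫ ζ, f (Real.cos θ) * restrictToSphere H' (spherePoint (k + 1) (θ, ζ))
        ∂(surfaceMeasure (k + 1)) = ((surfaceMeasure (k + 1)).real Set.univ *
          restrictToSphere H ξ) *
            (f (Real.cos θ) * (zonalPolynomial (k + 1) n).eval (Real.cos θ)) := by
      intro θ
      rw [integral_const_mul, integral_restrictToSphere_spherePoint hH' hn', hYξ]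
      ring
    -- Fubini: averaging over the parallels keeps integrability, and this is what makes the
    -- one-dimensional integrand integrable when the factor `Y ξ` does not vanish.
    have hI := hF'.integral_prod_left
    simp only [hmean] at hI
    constructor
    · intro hξ
      refine (intervalIntegrable_weight_iff (d := k + 1)
        fun t => f t * (zonalPolynomial (k + 1) n).eval t).2 ?_
      have h0 : (surfaceMeasure (k + 1)).real Set.univ * restrictToSphere H ξ ≠ 0 :=
        mul_ne_zero (surfaceMeasure_real_univ_ne_zero _) hξ
      exact (integrable_const_mul_iff h0.isUnit _).1 hI
    · have h1 := intervalIntegral_weight (d := k + 1)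
        fun t => f t * (zonalPolynomial (k + 1) n).eval t
      rw [h1, ← integral_const_mul]
      simp_rw [← hmean]
      rw [← integral_prod _ hF', ← hΨ.map_eq, integral_map hΨ.aemeasurable
        (hΨ.map_eq.symm ▸ hF.aestronglyMeasurable)]
      simp only [hinner, hY]
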